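/- Let $U$ be a unitary operator on $\mathbb{C}^3$ and let $\mathfrak{W}(U)=\{\langle z|Uz\rangle : z\in\mathbb{C}^3,\ \|z\|=1\}\subset\mathbb{C}$ be its numerical range. For a unit vector $z\in\mathbb{C}^3$ let $\rho_z$ be the orthogonal projection onto $\operatorname{span}\{z\}$, $\Theta_z=\operatorname{span}\{z\}^\perp$, $\Pi_1^z=\mathbb{I}-\rho_z$, $\Pi_2^z=\rho_z$. Let $\mathcal{F}_{U,\Pi(z)}$ be the partial iterated function system on the set of quantum states (positive semi-definite operators of trace one on $\mathbb{C}^3$) with probabilities $\mathsf{p}_i(\rho)=\operatorname{tr}(\Pi_i^zU\rho U^*)$ and evolution maps $\mathsf{F}_i(\rho)=\Pi_i^zU\rho U^*\Pi_i^z/\mathsf{p}_i(\rho)$, defined where $\mathsf{p}_i(\rho)>0$, $i\in\{1,2\}$. Let $\lambda_1,\lambda_2$ be the eigenvalues, counted with algebraic multiplicity, of $A=\Pi_1^zU|_{\Theta_z}\colon\Theta_z\to\Theta_z$, ordered so that $|\lambda_2|\le|\lambda_1|$, and, if $\lambda_1,\lambda_2\neq0$, put $\psi=\operatorname{Arg}(\lambda_2/\lambda_1)$.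 The Markov chain generated by $\mathcal{F}_{U,\Pi(z)}$ is called finite-elliptic if $0<|\lambda_2|=|\lambda_1|<1$ and $\psi\in\pi\mathbb{Q}\setminus\{0\}$, and $\infty$-elliptic if $0<|\lambda_2|=|\lambda_1|<1$ and $\psi\notin\pi\mathbb{Q}$. For $\omega\in\mathfrak{W}(U)$ write $\mathcal{F}_{U,\omega}$ for $\mathcal{F}_{U,\Pi(z)}$, where $z$ is any unit vector with $\langle z|Uz\rangle=\omega$; the type of the chain does not depend on the choice of $z$. Theorem. If $\operatorname{Int}\mathfrak{W}(U)\neq\varnothing$, then the sets $$\{\omega\in\mathfrak{W}(U) : \mathcal{F}_{U,\omega}\text{ generates a finite-elliptic chain}\}\quad\text{and}\quad\{\omega\in\mathfrak{W}(U) : \mathcal{F}_{U,\omega}\text{ generates an $\infty$-elliptic chain}\}$$ are both infinite. -/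

import Mathlib

open scoped ComplexOrder InnerProductSpace

/-- The Hilbert space `ℂ^d` with its standard inner product (antilinear in the first slot). -/
abbrev Qudit (d : ℕ) : Type := EuclideanSpace ℂ (Fin d)

/-- The space of linear maps on `ℂ^d`; here `star` is the adjoint and `*` the composition. -/
abbrev Op (d : ℕ) : Type := Qudit d →ₗ[ℂ] Qudit d

/-- Quantum states on `ℂ^d`: positive semi-definite operators of trace one. -/
def QState (d : ℕ) : Type :=
  {ρ : Op d // ρ.IsPositive ∧ LinearMap.trace ℂ (Qudit d) ρ = 1}

/-- A partial iterated function system on `X` with `k` evolution maps: the probabilities `p i`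
(non-negative and summing to one, hence with values in `[0, 1]`) and the evolution maps `F i`,
each defined exactly where `p i` is positive. -/
structure PIFS (X : Type*) (k : ℕ) where
  p : Fin k → X → ℝ
  p_nonneg : ∀ i x, 0 ≤ p i x
  sum_p : ∀ x, ∑ i, p i x = 1
  F : (i : Fin k) → {x : X // 0 < p i x} → X

/-- A projection valued measure on `ℂ^d` with `k` outcomes. -/
structure PVM (d k : ℕ) where
  proj : Fin k → Op d
  isStarProjection : ∀ i, IsStarProjection (proj i)
  ne_zero : ∀ i, proj i ≠ 0
  sum_proj : ∑ i, proj i = 1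

section PIFSOfPVM

variable {d k : ℕ}

/-- The unnormalised state after evolution by `U` and the `i`-th measurement result,
`Π_i U ρ U* Π_i`. -/
noncomputable def evolve (U : unitary (Op d)) (P : PVM d k) (i : Fin k) (ρ : Op d) : Op d :=
  P.proj i * ((U : Op d) * ρ * star (U : Op d)) * P.proj i

/-- The Born probability `tr (Π_i U ρ U*)` of the `i`-th result after evolution by `U`. -/
noncomputable def bornProb (U : unitary (Op d)) (P : PVM d k) (i : Fin k) (ρ : Op d) : ℝ :=
  (LinearMap.trace ℂ (Qudit d) (P.proj i * ((U : Op d) * ρ * star (U : Op d)))).re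

lemma evolve_isPositive (U : unitary (Op d)) (P : PVM d k) (i : Fin k) {ρ : Op d}
    (hρ : ρ.IsPositive) : (evolve U P i ρ).IsPositive := by
  have h1 : ((U : Op d) * ρ * star (U : Op d)).IsPositive := by
    have := hρ.conj_adjoint (U : Op d)
    simpa [Module.End.mul_eq_comp, LinearMap.star_eq_adjoint, LinearMap.comp_assoc] using this
  have h2 := h1.conj_adjoint (P.proj i)
  have h3 : LinearMap.adjoint (P.proj i) = P.proj i := by
    rw [← LinearMap.star_eq_adjoint]; exact (P.isStarProjection i).isSelfAdjoint
  rw [h3] at h2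
  simpa [evolve, Module.End.mul_eq_comp, LinearMap.comp_assoc] using h2

lemma trace_evolve (U : unitary (Op d)) (P : PVM d k) (i : Fin k) (ρ : Op d) :
    LinearMap.trace ℂ (Qudit d) (evolve U P i ρ) =
      LinearMap.trace ℂ (Qudit d) (P.proj i * ((U : Op d) * ρ * star (U : Op d))) := by
  rw [evolve, LinearMap.trace_mul_comm, ← mul_assoc, (P.isStarProjection i).isIdempotentElem.eq]

lemma trace_evolve_eq_bornProb (U : unitary (Op d)) (P : PVM d k) (i : Fin k) {ρ : Op d}
    (hρ : ρ.IsPositive) :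
    LinearMap.trace ℂ (Qudit d) (evolve U P i ρ) = (bornProb U P i ρ : ℂ) := by
  have h := (Complex.le_def.1 (evolve_isPositive U P i hρ).trace_nonneg).2
  apply Complex.ext
  · simp [bornProb, trace_evolve]
  · simpa using h.symm

/-- The PIFS generated by the unitary `U` and the PVM `P`: a state `ρ` yields the result `i` with
probability `tr (Π_i U ρ U*)` and then becomes `Π_i U ρ U* Π_i / tr (Π_i U ρ U*)`. -/
noncomputable def pifsOf (U : unitary (Op d)) (P : PVM d k) : PIFS (QState d) k where
  p i ρ := bornProb U P i ρ.1
  p_nonneg i ρ := by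
    have h := (Complex.le_def.1 (evolve_isPositive U P i ρ.2.1).trace_nonneg).1
    rw [trace_evolve_eq_bornProb U P i ρ.2.1] at h
    simpa using h
  sum_p ρ := by
    have hU : star (U : Op d) * (U : Op d) = 1 := Unitary.coe_star_mul_self U
    simp only [bornProb]
    rw [← Complex.re_sum, ← map_sum, ← Finset.sum_mul, P.sum_proj, one_mul,
      LinearMap.trace_mul_comm, ← mul_assoc, hU, one_mul, ρ.2.2, Complex.one_re]
  F i ρ := ⟨((bornProb U P i ρ.1.1)⁻¹ : ℂ) • evolve U P i ρ.1.1, by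
    have hp : (0 : ℝ) < bornProb U P i ρ.1.1 := ρ.2
    constructor
    · refine (evolve_isPositive U P i ρ.1.2.1).smul_of_nonneg ?_
      rw [← Complex.ofReal_inv]
      exact Complex.zero_le_real.2 (inv_nonneg.2 hp.le)
    · rw [map_smul, trace_evolve_eq_bornProb U P i ρ.1.2.1, smul_eq_mul]
      exact inv_mul_cancel₀ (Complex.ofReal_ne_zero.2 hp.ne')⟩

end PIFSOfPVM

/-- The orthogonal projection on `span {z}`. -/
noncomputable def rayProj {d : ℕ} (z : Qudit d) : Op d :=
  ((ℂ ∙ z).starProjection : Qudit d →L[ℂ] Qudit d)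

lemma rayProj_isStarProjection {d : ℕ} (z : Qudit d) : IsStarProjection (rayProj z) := by
  have h := isStarProjection_starProjection (𝕜 := ℂ) (U := ℂ ∙ z)
  refine ⟨?_, ?_⟩
  · have := h.isIdempotentElem.eq
    exact congrArg ContinuousLinearMap.toLinearMap this
  · have h2 := h.isSelfAdjoint
    rw [ContinuousLinearMap.isSelfAdjoint_iff_isSymmetric] at h2
    exact (LinearMap.isSymmetric_iff_isSelfAdjoint _).1 h2

/-- The PVM on `ℂ^3` consisting of the rank-two projection `1 - ρ_z` (first outcome) and the
rank-one projection `ρ_z` on `span {z}` (second outcome), for a unit vector `z`. -/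
noncomputable def ballPointPVM (z : Qudit 3) (hz : ‖z‖ = 1) : PVM 3 2 where
  proj := ![1 - rayProj z, rayProj z]
  isStarProjection i := by
    fin_cases i
    · exact (rayProj_isStarProjection z).one_sub
    · exact rayProj_isStarProjection z
  ne_zero i := by
    have hz0 : z ≠ 0 := by
      rintro rfl
      simp at hz
    fin_cases i
    · intro h
      have h1 : rayProj z = 1 := (sub_eq_zero.1 h).symm
      have htop : (ℂ ∙ z) = ⊤ := by
        rw [eq_top_iff]
        intro x _
        have hx : rayProj z x = x := by rw [h1]; rfl
        rw [← hx]
        exact Submodule.starProjection_apply_mem _ x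
      have := finrank_span_singleton (K := ℂ) hz0
      rw [htop, finrank_top] at this
      simp at this
    · intro h
      have hx : rayProj z z = z :=
        Submodule.starProjection_eq_self_iff.2 (Submodule.mem_span_singleton_self z)
      have h' : rayProj z = 0 := h
      rw [h'] at hx
      exact hz0 hx.symm
  sum_proj := by simp [Fin.sum_univ_two]

/-- The operator `A = Π₁ U |_Θ` on `Θ = (span {z})ᗮ`, where `Π₁` is the orthogonal projection
on `Θ`. -/
noncomputable def ballOp (U : unitary (Op 3)) (z : Qudit 3) :
    ((ℂ ∙ z)ᗮ : Submodule ℂ (Qudit 3)) →ₗ[ℂ] ((ℂ ∙ z)ᗮ : Submodule ℂ (Qudit 3)) :=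
  ((ℂ ∙ z)ᗮ.orthogonalProjectionOnto : Qudit 3 →ₗ[ℂ] (ℂ ∙ z)ᗮ) ∘ₗ (U : Op 3) ∘ₗ (ℂ ∙ z)ᗮ.subtype

/-- `t ∈ πℚ`. -/
def InPiRat (t : ℝ) : Prop := ∃ q : ℚ, t = Real.pi * (q : ℝ)

/-- The eigenvalues of `A = Π₁ U |_Θ`, listed with algebraic multiplicity as `l₁`, `l₂`, satisfy
`0 < |l₂| = |l₁| < 1`, and `ψ = Arg (l₂ / l₁)` lies in `πℚ \ {0}`. Whether `Arg` is taken in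
`(-π, π]` or in `[0, 2π)` makes no difference, and neither does the order of `l₁`, `l₂`. -/
def FiniteEllipticSpectrum (U : unitary (Op 3)) (z : Qudit 3) : Prop :=
  ∃ l₁ l₂ : ℂ, (ballOp U z).charpoly.roots = {l₁, l₂} ∧
    0 < ‖l₂‖ ∧ ‖l₂‖ = ‖l₁‖ ∧ ‖l₁‖ < 1 ∧
    InPiRat (Complex.arg (l₂ / l₁)) ∧ Complex.arg (l₂ / l₁) ≠ 0

/-- The eigenvalues of `A = Π₁ U |_Θ`, listed with algebraic multiplicity as `l₁`, `l₂`, satisfy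
`0 < |l₂| = |l₁| < 1`, and `ψ = Arg (l₂ / l₁)` does not lie in `πℚ`. -/
def InftyEllipticSpectrum (U : unitary (Op 3)) (z : Qudit 3) : Prop :=
  ∃ l₁ l₂ : ℂ, (ballOp U z).charpoly.roots = {l₁, l₂} ∧
    0 < ‖l₂‖ ∧ ‖l₂‖ = ‖l₁‖ ∧ ‖l₁‖ < 1 ∧
    ¬ InPiRat (Complex.arg (l₂ / l₁))

/-- The PIFS `S` on the qutrit states generates a finite-elliptic chain: it is the PIFS of a
unitary `U` and a PVM `{1 - ρ_z, ρ_z}` whose operator `A` has a finite-elliptic spectrum.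
(The PIFS determines `z` up to a phase and `A` up to a phase, hence `l₂ / l₁` and the moduli.) -/
def PIFS.GeneratesFiniteEllipticChain (S : PIFS (QState 3) 2) : Prop :=
  ∃ (U : unitary (Op 3)) (z : Qudit 3) (hz : ‖z‖ = 1),
    S = pifsOf U (ballPointPVM z hz) ∧ FiniteEllipticSpectrum U z

/-- The PIFS `S` on the qutrit states generates an `∞`-elliptic chain. -/
def PIFS.GeneratesInftyEllipticChain (S : PIFS (QState 3) 2) : Prop :=
  ∃ (U : unitary (Op 3)) (z : Qudit 3) (hz : ‖z‖ = 1),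
    S = pifsOf U (ballPointPVM z hz) ∧ InftyEllipticSpectrum U z

/-- The numerical range `{⟨z|Tz⟩ : ‖z‖ = 1}`. -/
def numRange {d : ℕ} (T : Op d) : Set ℂ :=
  {w | ∃ z : Qudit d, ‖z‖ = 1 ∧ ⟪z, T z⟫_ℂ = w}

open Filter Topology ComplexConjugate Polynomial

/-! Let `T` and `δ` be the trace and determinant of `U`. By `charpoly_ballOp`, the eigenvalues of
`A` have sum `T - ω` and product `δ * conj ω`. They are `l * exp (± i φ)` with `l ^ 2 = δ * conj ω`
as soon as `(T - ω)² = 4 c δ conj ω` with `c = cos² φ`; then `|l|² = |ω|`, so it remains to have `0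
< |ω| < 1`. It thus suffices to solve this equation inside the numerical range for every `c` in some
open interval: `φ` then fills an interval, which contains infinitely many rational and infinitely
many irrational multiples of `π`, and `c` can be read off from `ω`, so distinct `φ` give distinct
`ω`.

Since the numerical range has interior points, the eigenvalues of `U` are three distinct points of
the unit circle, and the triangle they span lies in the numerical range. The vertex `u₁` solves the
equation for `c₀ = |u₂ + u₃|² / 4`. If `u₂ + u₃ ≠ 0`, the implicit function theorem continues this
solution to nearby `c`, and its velocity at `c₀` points into the triangle or directly out of it, so
on one side of `c₀` the curve runs through the interior (`exists_Ioo_solution_of_add_ne_zero`). -/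

lemma Complex.conj_eq_inv_of_norm_one {u : ℂ} (h : ‖u‖ = 1) : conj u = u⁻¹ := by
  rw [Complex.inv_def, Complex.normSq_eq_norm_sq, h]; simp

/-! ### Solution curves of the equation in `w` -/

/-- The real-linear map `d ↦ A d + B conj d`. -/
noncomputable def addConjCLM (A B : ℂ) : ℂ →L[ℝ] ℂ :=
  (ContinuousLinearMap.mul ℝ ℂ A) + (ContinuousLinearMap.mul ℝ ℂ B) ∘L Complex.conjCLE.toContinuousLinearMap

lemma addConjCLM_apply (A B d : ℂ) : addConjCLM A B d = A * d + B * conj d := by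
  simp [addConjCLM]

/-- A non-zero kernel element `d` gives `‖A‖ * ‖d‖ = ‖B‖ * ‖d‖`. -/
lemma addConjCLM_injective {A B : ℂ} (h : ‖A‖ ≠ ‖B‖) :
    Function.Injective (addConjCLM A B) := by
  rw [injective_iff_map_eq_zero]
  intro d hd
  rw [addConjCLM_apply] at hd
  by_contra hne
  apply h
  have h1 : ‖A * d‖ = ‖B * conj d‖ := by rw [eq_neg_of_add_eq_zero_left hd, norm_neg]
  rw [norm_mul, norm_mul, RCLike.norm_conj] at h1
  exact mul_right_cancel₀ (norm_ne_zero_iff.2 hne) h1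

lemma addConjCLM_isInvertible {A B : ℂ} (h : ‖A‖ ≠ ‖B‖) : (addConjCLM A B).IsInvertible :=
  ⟨(LinearEquiv.ofInjectiveEndo (addConjCLM A B : ℂ →ₗ[ℝ] ℂ)
    (addConjCLM_injective h)).toContinuousLinearEquiv, rfl⟩

/-- Near a point with `‖T - w₀‖ ≠ ‖2 c₀ δ‖`, the solutions `w` of `(T - w)² = 4 c δ conj w` are
given by a differentiable function of `c`. -/
lemma exists_hasDerivAt_solution {T δ w₀ v : ℂ} {c₀ : ℝ}
    (h₀ : (T - w₀) ^ 2 = 4 * c₀ * δ * conj w₀)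
    (hinv : ‖-2 * (T - w₀)‖ ≠ ‖-4 * c₀ * δ‖)
    (hv : -2 * (T - w₀) * v + -4 * c₀ * δ * conj v = 4 * δ * conj w₀) :
    ∃ f : ℝ → ℂ, f c₀ = w₀ ∧ HasDerivAt f v c₀ ∧
      ∀ᶠ c in 𝓝 c₀, (T - f c) ^ 2 = 4 * c * δ * conj (f c) := by
  let F : ℝ × ℂ → ℂ := fun x => (T - x.2) ^ 2 - 4 * x.1 * δ * conj x.2
  let F' : ℝ × ℂ →L[ℝ] ℂ :=
    (addConjCLM (-2 * (T - w₀)) (-4 * c₀ * δ)) ∘L (ContinuousLinearMap.snd ℝ ℝ ℂ) +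
      (ContinuousLinearMap.fst ℝ ℝ ℂ).smulRight (-4 * δ * conj w₀)
  have hF : HasStrictFDerivAt F F' (c₀, w₀) := by
    have h1 : HasStrictFDerivAt (fun x : ℝ × ℂ => x.2) (ContinuousLinearMap.snd ℝ ℝ ℂ) (c₀, w₀) :=
      hasStrictFDerivAt_snd
    have h2 : HasStrictFDerivAt (fun x : ℝ × ℂ => (x.1 : ℂ))
        (Complex.ofRealCLM ∘L ContinuousLinearMap.fst ℝ ℝ ℂ) (c₀, w₀) :=
      Complex.ofRealCLM.hasStrictFDerivAt.comp _ hasStrictFDerivAt_fst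
    have h3 : HasStrictFDerivAt (fun x : ℝ × ℂ => conj x.2)
        (Complex.conjCLE.toContinuousLinearMap ∘L ContinuousLinearMap.snd ℝ ℝ ℂ) (c₀, w₀) :=
      Complex.conjCLE.toContinuousLinearMap.hasStrictFDerivAt.comp _ h1
    have h4 := ((h1.const_sub T).pow 2).sub (((h2.const_mul 4).mul_const δ).mul h3)
    refine h4.congr_fderiv ?_
    ext x
    · simp [F', addConjCLM_apply]; ring
    · simp [F', addConjCLM_apply]; ring
  have hF2 : (F' ∘L .inr ℝ ℝ ℂ) = addConjCLM (-2 * (T - w₀)) (-4 * c₀ * δ) := by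
    ext; simp [F']
  have hI : (F' ∘L .inr ℝ ℝ ℂ).IsInvertible := hF2 ▸ addConjCLM_isInvertible hinv
  have hFu : F (c₀, w₀) = 0 := sub_eq_zero.2 h₀
  let f := hF.implicitFunctionOfProdDomain hI
  have hf0 : f c₀ = w₀ :=
    (hF.eventually_apply_eq_iff_implicitFunctionOfProdDomain hI).self_of_nhds.mp rfl
  have hev := hF.eventually_apply_implicitFunctionOfProdDomain hI
  have hd : HasDerivAt f (fderiv ℝ f c₀ 1) c₀ :=
    (hF.hasStrictFDerivAt_implicitFunctionOfProdDomain hI).hasFDerivAt.differentiableAt.hasFDerivAt.hasDerivAt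
  set v' := fderiv ℝ f c₀ 1
  have hcomp : HasDerivAt (fun c => F (c, f c)) (F' (1, v')) c₀ := by
    have h5 : HasDerivAt (fun c => (c, f c)) (1, v') c₀ := (hasDerivAt_id c₀).prodMk hd
    have h6 : HasFDerivAt F F' (c₀, f c₀) := by rw [hf0]; exact hF.hasFDerivAt
    exact h6.comp_hasDerivAt c₀ h5
  have hconst : HasDerivAt (fun c => F (c, f c)) 0 c₀ :=
    (hasDerivAt_const c₀ (F (c₀, w₀))).congr_of_eventuallyEq hev
  -- Differentiating the constant `F (c, f c)` shows that `v'` solves the linear equation `hv`,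
  -- whose solution is unique.
  have hv' : v' = v := by
    apply addConjCLM_injective hinv
    have h7 := hcomp.unique hconst
    rw [addConjCLM_apply (d := v), hv]
    simp only [F', add_apply, ContinuousLinearMap.comp_apply,
      ContinuousLinearMap.coe_snd', ContinuousLinearMap.smulRight_apply,
      ContinuousLinearMap.coe_fst', one_smul] at h7
    rw [eq_neg_of_add_eq_zero_left h7]; ring
  refine ⟨f, hf0, hv' ▸ hd, ?_⟩
  filter_upwards [hev] with c hc
  exact sub_eq_zero.1 (hc.trans hFu)

/-- A function with zero value and non-zero derivative has a sign on each side. -/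
lemma HasDerivAt.eventually_mul_pos {f : ℝ → ℝ} {d c₀ : ℝ} (hf : HasDerivAt f d c₀)
    (h0 : f c₀ = 0) (hd : d ≠ 0) :
    ∀ᶠ c in 𝓝 c₀, 0 < (c - c₀) * d → 0 < f c := by
  have h1 := (hasDerivAt_iff_tendsto_slope.1 hf).mul_const d
  have h2 : ∀ᶠ c in 𝓝[≠] c₀, 0 < slope f c₀ c * d :=
    h1.eventually (lt_mem_nhds (mul_self_pos.2 hd))
  rw [eventually_nhdsWithin_iff] at h2
  filter_upwards [h2] with c hc hpos
  have hne : c - c₀ ≠ 0 := fun h => by simp [h] at hpos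
  have h3 := mul_pos (hc (sub_ne_zero.1 hne)) hpos
  rw [slope_def_field, h0, sub_zero] at h3
  have h4 : f c / (c - c₀) * d * ((c - c₀) * d) = f c * d ^ 2 := by field_simp
  rw [h4] at h3
  exact pos_of_mul_pos_left h3 (sq_nonneg d)

/-! ### Triangles inscribed in the unit circle -/

/-- A line meets the circle at most twice: with `conj u = u⁻¹`, collinearity becomes the vanishing
of a product of differences of the vertices. -/
lemma im_conj_mul_ne_zero {u₁ u₂ u₃ : ℂ} (h₁ : ‖u₁‖ = 1) (h₂ : ‖u₂‖ = 1) (h₃ : ‖u₃‖ = 1)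
    (h12 : u₁ ≠ u₂) (h13 : u₁ ≠ u₃) (h23 : u₂ ≠ u₃) :
    (conj (u₃ - u₁) * (u₂ - u₁)).im ≠ 0 := by
  intro h
  have hz1 : u₁ ≠ 0 := norm_ne_zero_iff.1 (by simp [h₁])
  have hz2 : u₂ ≠ 0 := norm_ne_zero_iff.1 (by simp [h₂])
  have hz3 : u₃ ≠ 0 := norm_ne_zero_iff.1 (by simp [h₃])
  have h4 := Complex.conj_eq_iff_im.2 h
  have h6 : (u₃ - u₁) * (u₂⁻¹ - u₁⁻¹) = (u₃⁻¹ - u₁⁻¹) * (u₂ - u₁) := by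
    simpa only [map_mul, map_sub, map_inv₀, Complex.conj_conj, inv_inv, Complex.conj_eq_inv_of_norm_one h₁,
      Complex.conj_eq_inv_of_norm_one h₂, Complex.conj_eq_inv_of_norm_one h₃] using h4
  field_simp at h6
  have h5 : (u₃ - u₁) * (u₂ - u₁) * (u₂ - u₃) = 0 := by linear_combination h6
  simp [sub_eq_zero, h12.symm, h13.symm, h23] at h5

/-- Coordinates in a real basis of `ℂ`. -/
lemma eq_im_div_mul_add {a b : ℂ} (h : (conj b * a).im ≠ 0) (z : ℂ) :
    z = ((conj b * z).im / (conj b * a).im : ℝ) * a +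
      ((conj a * z).im / (conj a * b).im : ℝ) * b := by
  have h' : (conj a * b).im = -(conj b * a).im := by simp; ring
  rw [h']
  have hc : ((conj b * a).im : ℂ) ≠ 0 := Complex.ofReal_ne_zero.2 h
  push_cast
  field_simp
  apply Complex.ext <;> simp <;> ring

/-- Strict convexity of the disc already makes the normalised combination of `u₁` and `u₂` shorter
than one. -/
lemma norm_combo_lt_one {u₁ u₂ u₃ : ℂ} (h₁ : ‖u₁‖ = 1) (h₂ : ‖u₂‖ = 1) (h₃ : ‖u₃‖ = 1)
    (h12 : u₁ ≠ u₂) {w₁ w₂ w₃ : ℝ} (hw₁ : 0 < w₁) (hw₂ : 0 < w₂) (hw₃ : 0 < w₃)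
    (hw : w₁ + w₂ + w₃ = 1) : ‖w₁ * u₁ + w₂ * u₂ + w₃ * u₃‖ < 1 := by
  have hs : 0 < w₁ + w₂ := by positivity
  have hlt := norm_combo_lt_of_ne h₁.le h₂.le h12 (div_pos hw₁ hs) (div_pos hw₂ hs)
    (by field_simp)
  have he : (w₁ * u₁ + w₂ * u₂ : ℂ) =
      (w₁ + w₂ : ℝ) • ((w₁ / (w₁ + w₂)) • u₁ + (w₂ / (w₁ + w₂)) • u₂) := by
    have hsC : (w₁ + w₂ : ℂ) ≠ 0 := by exact_mod_cast hs.ne'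
    simp only [smul_add, Complex.real_smul]
    push_cast
    field_simp
  calc ‖w₁ * u₁ + w₂ * u₂ + w₃ * u₃‖ ≤ ‖w₁ * u₁ + w₂ * u₂‖ + ‖w₃ * u₃‖ := norm_add_le _ _
    _ < (w₁ + w₂) * 1 + w₃ := by
      rw [he, norm_smul, norm_mul, h₃, Complex.norm_real, Real.norm_of_nonneg hs.le,
        Real.norm_of_nonneg hw₃.le, mul_one]
      gcongr
    _ = 1 := by linarith

/-- For a triangle inscribed in the unit circle with vertices `u₁`, `u₂`, `u₃`, centroid `T / 3`
and `δ = u₁ u₂ u₃`, a solution curve of `(T - w)² = 4 c δ conj w` starts in the vertex `u₁` and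
enters the interior of the triangle along the symmedian. -/
lemma exists_Ioo_solution_of_add_ne_zero {u₁ u₂ u₃ : ℂ} (h₁ : ‖u₁‖ = 1) (h₂ : ‖u₂‖ = 1)
    (h₃ : ‖u₃‖ = 1) (h12 : u₁ ≠ u₂) (h13 : u₁ ≠ u₃) (h23 : u₂ ≠ u₃) (hs : u₂ + u₃ ≠ 0) :
    ∃ a b : ℝ, 0 ≤ a ∧ a < b ∧ b ≤ 1 ∧ ∀ c ∈ Set.Ioo a b, ∃ w ∈ convexHull ℝ {u₁, u₂, u₃},
      (u₁ + u₂ + u₃ - w) ^ 2 = 4 * c * (u₁ * u₂ * u₃) * conj w ∧ w ≠ 0 ∧ ‖w‖ < 1 := by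
  have hz1 : u₁ ≠ 0 := norm_ne_zero_iff.1 (by simp [h₁])
  have hz2 : u₂ ≠ 0 := norm_ne_zero_iff.1 (by simp [h₂])
  have hz3 : u₃ ≠ 0 := norm_ne_zero_iff.1 (by simp [h₃])
  have c1 := Complex.conj_eq_inv_of_norm_one h₁
  have c2 := Complex.conj_eq_inv_of_norm_one h₂
  have c3 := Complex.conj_eq_inv_of_norm_one h₃
  have ha : u₂ - u₁ ≠ 0 := sub_ne_zero.2 h12.symm
  have hb : u₃ - u₁ ≠ 0 := sub_ne_zero.2 h13.symm
  have hab : u₃ - u₂ ≠ 0 := sub_ne_zero.2 h23.symm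
  -- The value of `c` for which `w = u₁` solves the equation.
  obtain ⟨c₀, hc₀⟩ : ∃ c₀ : ℝ, c₀ = ‖u₂ + u₃‖ ^ 2 / 4 := ⟨_, rfl⟩
  have hspos : 0 < ‖u₂ + u₃‖ := norm_pos_iff.2 hs
  have hslt : ‖u₂ + u₃‖ < 2 := by
    have := norm_combo_lt_of_ne h₂.le h₃.le h23 (a := 1/2) (b := 1/2) (by norm_num) (by norm_num)
      (by norm_num)
    rw [← smul_add, norm_smul] at this
    norm_num at this
    linarith
  have hc₀pos : 0 < c₀ := by rw [hc₀]; positivity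
  have hc₀lt : c₀ < 1 := by rw [hc₀]; nlinarith
  have hc₀C : (4 * c₀ : ℂ) = (u₂ + u₃) ^ 2 / (u₂ * u₃) := by
    have h4 : (4 * c₀ : ℂ) = conj (u₂ + u₃) * (u₂ + u₃) := by
      rw [Complex.conj_mul', hc₀]; push_cast; ring
    rw [h4, map_add, c2, c3]; field_simp; ring
  -- The scalar for which the `v` below solves the linearised equation. It is real because it is
  -- unchanged when each `uᵢ` is replaced by its inverse.
  obtain ⟨K, hK⟩ : ∃ K : ℂ, K = -(4 * u₂ * u₃ * (u₂ - u₁) * (u₃ - u₁)) /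
    (u₁ * (u₃ - u₂) ^ 2 * (u₂ + u₃)) := ⟨_, rfl⟩
  have hKne : K ≠ 0 := by
    rw [hK]
    refine div_ne_zero (neg_ne_zero.2 ?_) ?_ <;> simp [*]
  obtain ⟨k, rfl⟩ : ∃ k : ℝ, K = k := by
    refine ⟨K.re, (Complex.conj_eq_iff_re.1 ?_).symm⟩
    rw [hK]
    have hs' : u₃ + u₂ ≠ 0 := by rwa [add_comm]
    have hab' : u₂ - u₃ ≠ 0 := sub_ne_zero.2 h23
    have e1 : u₂⁻¹ - u₁⁻¹ = -(u₂ - u₁) / (u₁ * u₂) := by field_simp; ring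
    have e2 : u₃⁻¹ - u₁⁻¹ = -(u₃ - u₁) / (u₁ * u₃) := by field_simp; ring
    have e3 : u₃⁻¹ - u₂⁻¹ = -(u₃ - u₂) / (u₂ * u₃) := by field_simp; ring
    have e4 : u₂⁻¹ + u₃⁻¹ = (u₂ + u₃) / (u₂ * u₃) := by field_simp; ring
    have e5 : conj (4 : ℂ) = 4 := Complex.conj_ofNat 4
    simp only [map_div₀, map_mul, map_neg, map_sub, map_add, map_pow, c1, c2, c3, e1, e2, e3, e4, e5]
    field_simp
  have hk : k ≠ 0 := by simpa using hKne
  -- As `1 / conj a = a / ‖a‖²`, the coordinates of `v` along the two sides at `u₁` are `k` over the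
  -- squared side lengths.
  obtain ⟨v, hv⟩ : ∃ v : ℂ, v = k / conj (u₂ - u₁) + k / conj (u₃ - u₁) := ⟨_, rfl⟩
  have ca : conj (u₂ - u₁) = -(u₂ - u₁) / (u₁ * u₂) := by
    rw [map_sub, c1, c2]; field_simp; ring
  have cb : conj (u₃ - u₁) = -(u₃ - u₁) / (u₁ * u₃) := by
    rw [map_sub, c1, c3]; field_simp; ring
  have hvc : conj v = k / (u₂ - u₁) + k / (u₃ - u₁) := by
    rw [hv, map_add, map_div₀, map_div₀, Complex.conj_conj, Complex.conj_conj, Complex.conj_ofReal]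
  have hT : u₁ + u₂ + u₃ - u₁ = u₂ + u₃ := by ring
  -- With `s = u₂ + u₃`, the invertibility condition reads `2‖s‖ ≠ ‖s‖²`, which holds since `0 < ‖s‖
  -- < 2`.
  obtain ⟨f, hf0, hfd, hfe⟩ := exists_hasDerivAt_solution (T := u₁ + u₂ + u₃)
    (δ := u₁ * u₂ * u₃) (w₀ := u₁) (v := v) (c₀ := c₀)
    (by rw [hT, hc₀C, c1]; field_simp)
    (by
      rw [hT]
      simp only [norm_mul, norm_neg, h₁, h₂, h₃, Complex.norm_real, Real.norm_of_nonneg hc₀pos.le]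
      norm_num
      rw [hc₀]
      intro h
      have : ‖u₂ + u₃‖ * (‖u₂ + u₃‖ - 2) = 0 := by linarith
      rcases mul_eq_zero.1 this with h | h <;> linarith)
    (by
      have h4 : -4 * (c₀ : ℂ) = -((u₂ + u₃) ^ 2 / (u₂ * u₃)) := by rw [← hc₀C]; ring
      rw [hT, h4, hvc, hv, ca, cb, c1, hK]
      field_simp
      ring)
  have hD := im_conj_mul_ne_zero h₁ h₂ h₃ h12 h13 h23
  have hD' := im_conj_mul_ne_zero h₁ h₃ h₂ h13 h12 h23.symm
  -- Barycentric weights of `f c` at `u₂` and `u₃`; both vanish at `c₀`.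
  let w₂ : ℝ → ℝ := fun c => (conj (u₃ - u₁) * (f c - u₁)).im / (conj (u₃ - u₁) * (u₂ - u₁)).im
  let w₃ : ℝ → ℝ := fun c => (conj (u₂ - u₁) * (f c - u₁)).im / (conj (u₂ - u₁) * (u₃ - u₁)).im
  have hder : ∀ a b : ℂ, HasDerivAt
      (fun c => (conj b * (f c - u₁)).im / (conj b * a).im)
      ((conj b * v).im / (conj b * a).im) c₀ := fun a b => by
    have h5 : HasDerivAt (fun c => conj b * (f c - u₁)) (conj b * v) c₀ :=
      (hfd.sub_const u₁).const_mul _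
    exact (Complex.imCLM.hasFDerivAt.comp_hasDerivAt c₀ h5).div_const _
  have hval : ∀ a b : ℂ, a ≠ 0 → b ≠ 0 → (conj b * a).im ≠ 0 → v = k / conj a + k / conj b →
      (conj b * v).im / (conj b * a).im = k * (‖a‖ ^ 2)⁻¹ := by
    intro a b ha hb hab hv
    have h6 : conj b * v = ((k * (‖a‖ ^ 2)⁻¹ : ℝ) : ℂ) * (conj b * a) + k := by
      have h7 : conj a ≠ 0 := by simpa using ha
      have h8 : conj b ≠ 0 := by simpa using hb
      rw [hv]; push_cast; rw [← Complex.conj_mul']; field_simp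
    rw [h6, Complex.add_im, Complex.im_ofReal_mul, Complex.ofReal_im, add_zero,
      mul_div_cancel_right₀ _ hab]
  have hw₂ : HasDerivAt w₂ (k * (‖u₂ - u₁‖ ^ 2)⁻¹) c₀ := by
    rw [← hval _ _ ha hb hD hv]; exact hder _ _
  have hw₃ : HasDerivAt w₃ (k * (‖u₃ - u₁‖ ^ 2)⁻¹) c₀ := by
    rw [← hval _ _ hb ha hD' (by rw [hv, add_comm])]; exact hder _ _
  have hw₂0 : w₂ c₀ = 0 := by simp [w₂, hf0]
  have hw₃0 : w₃ c₀ = 0 := by simp [w₃, hf0]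
  have hpa : 0 < (‖u₂ - u₁‖ ^ 2)⁻¹ := inv_pos.2 (pow_pos (norm_pos_iff.2 ha) 2)
  have hpb : 0 < (‖u₃ - u₁‖ ^ 2)⁻¹ := inv_pos.2 (pow_pos (norm_pos_iff.2 hb) 2)
  -- Both weights have derivatives with the sign of `k`, so both are positive where `c - c₀` has
  -- that sign.
  have hev : ∀ᶠ c in 𝓝 c₀, 0 < (c - c₀) * k → ∃ w ∈ convexHull ℝ {u₁, u₂, u₃},
      (u₁ + u₂ + u₃ - w) ^ 2 = 4 * c * (u₁ * u₂ * u₃) * conj w ∧ w ≠ 0 ∧ ‖w‖ < 1 := by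
    have hne : ∀ᶠ c in 𝓝 c₀, f c ≠ 0 :=
      hfd.continuousAt.eventually_ne (by rwa [hf0])
    have hlt : ∀ᶠ c in 𝓝 c₀, w₂ c + w₃ c < 1 :=
      (hw₂.continuousAt.add hw₃.continuousAt).eventually (gt_mem_nhds (by simp [hw₂0, hw₃0]))
    filter_upwards [hne, hlt, hfe, hw₂.eventually_mul_pos hw₂0 (mul_ne_zero hk hpa.ne'),
      hw₃.eventually_mul_pos hw₃0 (mul_ne_zero hk hpb.ne')] with c hne hlt hfe h2 h3 hpos
    replace h2 := h2 (by rw [← mul_assoc]; exact mul_pos hpos hpa)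
    replace h3 := h3 (by rw [← mul_assoc]; exact mul_pos hpos hpb)
    have hf : f c = ((1 - w₂ c - w₃ c : ℝ) : ℂ) * u₁ + w₂ c * u₂ + w₃ c * u₃ := by
      have : f c - u₁ = w₂ c * (u₂ - u₁) + w₃ c * (u₃ - u₁) := eq_im_div_mul_add hD (f c - u₁)
      push_cast; linear_combination this
    refine ⟨f c, ?_, hfe, hne, ?_⟩
    · rw [hf]
      have hc := convex_convexHull ℝ ({u₁, u₂, u₃} : Set ℂ)
      have := hc.sum_mem (t := Finset.univ) (w := ![1 - w₂ c - w₃ c, w₂ c, w₃ c])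
        (z := ![u₁, u₂, u₃]) (by intro i _; fin_cases i <;> simp <;> linarith)
        (by simp [Fin.sum_univ_three]; ring)
        (by intro i _; apply subset_convexHull; fin_cases i <;> simp)
      simpa [Fin.sum_univ_three] using this
    · rw [hf]
      exact norm_combo_lt_one h₁ h₂ h₃ h12 (by linarith) h2 h3 (by ring)
  obtain ⟨ε, hε, hball⟩ := Metric.eventually_nhds_iff.1 hev
  rcases hk.lt_or_gt with hk | hk
  · refine ⟨max 0 (c₀ - ε), c₀, le_max_left _ _, max_lt hc₀pos (by linarith), hc₀lt.le, ?_⟩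
    rintro c ⟨h5, h6⟩
    have h7 := (le_max_right _ _).trans_lt h5
    exact hball (by rw [Real.dist_eq, abs_lt]; constructor <;> linarith) (by nlinarith)
  · refine ⟨c₀, min 1 (c₀ + ε), hc₀pos.le, lt_min hc₀lt (by linarith), min_le_left _ _, ?_⟩
    rintro c ⟨h5, h6⟩
    have h7 := h6.trans_le (min_le_right _ _)
    exact hball (by rw [Real.dist_eq, abs_lt]; constructor <;> linarith) (by nlinarith)

/-- If `u₂` and `u₃` are antipodal, then `u₁` and `u₃` are not, and the curve can start in `u₂`. -/
lemma exists_Ioo_solution {u₁ u₂ u₃ : ℂ} (h₁ : ‖u₁‖ = 1) (h₂ : ‖u₂‖ = 1)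
    (h₃ : ‖u₃‖ = 1) (h12 : u₁ ≠ u₂) (h13 : u₁ ≠ u₃) (h23 : u₂ ≠ u₃) :
    ∃ a b : ℝ, 0 ≤ a ∧ a < b ∧ b ≤ 1 ∧ ∀ c ∈ Set.Ioo a b, ∃ w ∈ convexHull ℝ {u₁, u₂, u₃},
      (u₁ + u₂ + u₃ - w) ^ 2 = 4 * c * (u₁ * u₂ * u₃) * conj w ∧ w ≠ 0 ∧ ‖w‖ < 1 := by
  by_cases hs : u₂ + u₃ = 0
  · have hs' : u₁ + u₃ ≠ 0 := fun h => h12 (add_right_cancel (h.trans hs.symm))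
    have := exists_Ioo_solution_of_add_ne_zero h₂ h₁ h₃ h12.symm h23 h13 hs'
    rwa [Set.insert_comm, add_comm u₂ u₁, mul_comm u₂ u₁] at this
  · exact exists_Ioo_solution_of_add_ne_zero h₁ h₂ h₃ h12 h13 h23 hs

/-! ### Eigenbases and the numerical range -/

/-- A unitary operator has an orthonormal basis of eigenvectors, with eigenvalues of modulus
one. -/
lemma exists_orthonormalBasis_eigenvectors {d : ℕ} (U : unitary (Op d)) :
    ∃ (b : OrthonormalBasis (Fin d) ℂ (Qudit d)) (u : Fin d → ℂ),
      (∀ i, (U : Op d) (b i) = u i • b i) ∧ ∀ i, ‖u i‖ = 1 := by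
  classical
  -- Normality makes the real and imaginary parts commuting symmetric operators, hence
  -- simultaneously diagonalisable.
  have hN : IsStarNormal (U : Op d) :=
    ⟨(Unitary.coe_star_mul_self U).trans (Unitary.coe_mul_star_self U).symm⟩
  have hA : LinearMap.IsSymmetric (realPart (U : Op d) : Op d) :=
    (LinearMap.isSymmetric_iff_isSelfAdjoint _).2 (realPart (U : Op d)).2
  have hB : LinearMap.IsSymmetric (imaginaryPart (U : Op d) : Op d) :=
    (LinearMap.isSymmetric_iff_isSelfAdjoint _).2 (imaginaryPart (U : Op d)).2
  have hAB : Commute (realPart (U : Op d) : Op d) (imaginaryPart (U : Op d) : Op d) :=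
    (isStarNormal_iff_commute_realPart_imaginaryPart).1 hN
  have hint₀ := LinearMap.IsSymmetric.directSum_isInternal_of_commute hA hB hAB
  have horth₀ := LinearMap.IsSymmetric.orthogonalFamily_eigenspace_inf_eigenspace hA hB
  -- The joint eigenspaces are indexed by all of `ℂ × ℂ`; a subordinate basis needs a finite index
  -- type, so the zero ones are discarded.
  have hfin := WellFoundedGT.finite_ne_bot_of_iSupIndep hint₀.submodule_iSupIndep
  have hint := (DirectSum.isInternal_ne_bot_iff).2 hint₀
  have horth := horth₀.comp (Subtype.val_injective (p := fun i : ℂ × ℂ =>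
    Module.End.eigenspace (realPart (U : Op d) : Op d) i.2 ⊓
      Module.End.eigenspace (imaginaryPart (U : Op d) : Op d) i.1 ≠ ⊥))
  let _ : Fintype {i : ℂ × ℂ // Module.End.eigenspace (realPart (U : Op d) : Op d) i.2 ⊓
      Module.End.eigenspace (imaginaryPart (U : Op d) : Op d) i.1 ≠ ⊥} := hfin.fintype
  have hn : Module.finrank ℂ (Qudit d) = d := by simp
  let b := hint.subordinateOrthonormalBasis hn horth
  let e := fun i => (hint.subordinateOrthonormalBasisIndex hn i horth).1
  have hbe : ∀ i, (U : Op d) (b i) = ((e i).2 + Complex.I * (e i).1) • b i := fun i => by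
    have hmem := hint.subordinateOrthonormalBasis_subordinate hn i horth
    have h1 := Module.End.mem_eigenspace_iff.1 hmem.1
    have h2 := Module.End.mem_eigenspace_iff.1 hmem.2
    conv_lhs => rw [← realPart_add_I_smul_imaginaryPart (U : Op d)]
    rw [LinearMap.add_apply, LinearMap.smul_apply, add_smul, mul_smul]
    exact congrArg₂ _ h1 (congrArg _ h2)
  refine ⟨b, _, hbe, fun i => ?_⟩
  have h3 : ⟪(U : Op d) (b i), (U : Op d) (b i)⟫_ℂ = ⟪b i, b i⟫_ℂ := by
    rw [← LinearMap.adjoint_inner_right, ← LinearMap.star_eq_adjoint, ← Module.End.mul_apply,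
      Unitary.coe_star_mul_self, Module.End.one_apply]
  have h4 : ‖(U : Op d) (b i)‖ = 1 := by
    rw [@norm_eq_sqrt_re_inner ℂ, h3, ← @norm_eq_sqrt_re_inner ℂ, b.norm_eq_one]
  rwa [hbe, norm_smul, b.norm_eq_one, mul_one] at h4

section Eigenbasis

variable {d : ℕ} {T : Op d} {b : OrthonormalBasis (Fin d) ℂ (Qudit d)} {u : Fin d → ℂ}

lemma inner_apply_eq_sum_of_eigenbasis (h : ∀ i, T (b i) = u i • b i) (z : Qudit d) :
    ⟪z, T z⟫_ℂ = ∑ i, ((‖⟪b i, z⟫_ℂ‖ ^ 2 : ℝ) : ℂ) * u i := by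
  have hz : T z = ∑ i, (⟪b i, z⟫_ℂ * u i) • b i := by
    conv_lhs => rw [← b.sum_repr' z]
    simp [h, smul_smul]
  rw [hz, inner_sum]
  refine Finset.sum_congr rfl fun i _ => ?_
  rw [inner_smul_right, ← inner_conj_symm z (b i), mul_right_comm, Complex.mul_conj']
  push_cast; rfl

/-- Convex weights `q i` are realised by the unit vector with coordinates `√(q i)`. -/
lemma convexHull_subset_numRange (h : ∀ i, T (b i) = u i • b i) :
    convexHull ℝ (Set.range u) ⊆ numRange T := by
  intro w hw
  rw [convexHull_range_eq_exists_affineCombination] at hw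
  obtain ⟨s, p, hp0, hp1, rfl⟩ := hw
  rw [s.affineCombination_eq_linear_combination _ _ hp1]
  let q : Fin d → ℝ := fun i => if i ∈ s then p i else 0
  have hq : ∀ i, 0 ≤ q i := fun i => by
    by_cases hi : i ∈ s
    · simpa [q, hi] using hp0 i hi
    · simp [q, hi]
  let z : Qudit d := ∑ i, ((√(q i) : ℝ) : ℂ) • b i
  have hzi : ∀ i, ‖⟪b i, z⟫_ℂ‖ ^ 2 = q i := fun i => by
    rw [b.orthonormal.inner_right_fintype, Complex.norm_real, Real.norm_of_nonneg (Real.sqrt_nonneg _),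
      Real.sq_sqrt (hq i)]
  refine ⟨z, ?_, ?_⟩
  · have := b.sum_sq_norm_inner_right z
    simp only [hzi] at this
    rw [← pow_eq_one_iff_of_nonneg (norm_nonneg z) two_ne_zero, ← this, ← hp1]
    simp [q]
  · rw [inner_apply_eq_sum_of_eigenbasis h]
    simp [hzi, q, apply_ite Complex.ofReal, ite_mul]

lemma trace_eq_sum_of_eigenbasis (h : ∀ i, T (b i) = u i • b i) :
    LinearMap.trace ℂ _ T = ∑ i, u i := by
  rw [LinearMap.trace_eq_matrix_trace ℂ b.toBasis]
  simp [Matrix.trace, LinearMap.toMatrix_apply, h]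

lemma det_eq_prod_of_eigenbasis (h : ∀ i, T (b i) = u i • b i) :
    LinearMap.det T = ∏ i, u i := by
  rw [← LinearMap.det_toMatrix b.toBasis]
  have : LinearMap.toMatrix b.toBasis b.toBasis T = Matrix.diagonal u := by
    ext i j
    rcases eq_or_ne i j with rfl | hij <;> simp [LinearMap.toMatrix_apply, *]
  rw [this, Matrix.det_diagonal]

end Eigenbasis

/-! ### The compression of `U` -/

/-- The characteristic polynomial of the compression of `U` to the orthogonal complement of `z`
depends only on `⟨z|Uz⟩`. -/
lemma charpoly_ballOp (U : unitary (Op 3)) {z : Qudit 3} (hz : ‖z‖ = 1) :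
    (ballOp U z).charpoly =
      X ^ 2 - C (LinearMap.trace ℂ _ (U : Op 3) - ⟪z, (U : Op 3) z⟫_ℂ) * X +
        C (LinearMap.det (U : Op 3) * conj ⟪z, (U : Op 3) z⟫_ℂ) := by
  have hz0 : z ≠ 0 := norm_ne_zero_iff.1 (by simp [hz])
  obtain ⟨b, hb⟩ : ∃ b : OrthonormalBasis (Fin 3) ℂ (Qudit 3), b 0 = z := by
    obtain ⟨b, hb⟩ := Orthonormal.exists_orthonormalBasis_extension_of_card_eq
      (𝕜 := ℂ) (E := Qudit 3) (ι := Fin 3) (by simp) (v := fun _ => z) (s := {0})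
      (by
        constructor
        · intro i; exact hz
        · intro i j hij; exact absurd (Subsingleton.elim i j) hij)
    exact ⟨b, hb 0 rfl⟩
  have hmem : ∀ i : Fin 2, b i.succ ∈ (ℂ ∙ z)ᗮ := fun i => by
    rw [Submodule.mem_orthogonal_singleton_iff_inner_right, ← hb]
    exact b.orthonormal.2 (Fin.succ_ne_zero i).symm
  let v : Fin 2 → (ℂ ∙ z)ᗮ := fun i => ⟨b i.succ, hmem i⟩
  have hv : Orthonormal ℂ v := by
    constructor
    · intro i; exact b.orthonormal.1 _
    · intro i j hij; exact b.orthonormal.2 ((Fin.succ_injective 2).ne hij)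
  have hfr : Module.finrank ℂ (ℂ ∙ z)ᗮ = 2 := by
    have : Fact (Module.finrank ℂ (Qudit 3) = 2 + 1) := ⟨by simp⟩
    exact Submodule.finrank_orthogonal_span_singleton hz0
  let e : OrthonormalBasis (Fin 2) ℂ (ℂ ∙ z)ᗮ := OrthonormalBasis.mk hv
    (hv.linearIndependent.span_eq_top_of_card_eq_finrank (by simp [hfr])).ge
  have he : ∀ i, e i = v i := fun i => by simp [e]
  let M := LinearMap.toMatrixOrthonormal b (U : Op 3)
  let N := LinearMap.toMatrixOrthonormal e (ballOp U z)
  -- In a basis starting with `z`, the matrix of `A` is that of `U` without its first row and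
  -- column.
  have hN : ∀ i j, N i j = M i.succ j.succ := fun i j => by
    simp only [N, M, LinearMap.toMatrixOrthonormal_apply_apply, he]
    simp only [ballOp, v, LinearMap.comp_apply, Submodule.subtype_apply]
    exact Submodule.inner_orthogonalProjectionOnto_eq_of_mem_left _ _
  have hM0 : M 0 0 = ⟪z, (U : Op 3) z⟫_ℂ := by
    simp only [M, LinearMap.toMatrixOrthonormal_apply_apply, hb]
  have hchar : (ballOp U z).charpoly = N.charpoly :=
    (LinearMap.charpoly_toMatrix (ballOp U z) e.toBasis).symm
  have htr : LinearMap.trace ℂ _ (U : Op 3) = M.trace :=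
    LinearMap.trace_eq_matrix_trace ℂ b.toBasis _
  have hdet : LinearMap.det (U : Op 3) = M.det :=
    (LinearMap.det_toMatrix b.toBasis _).symm
  have hMM : M * star M = 1 := by
    rw [← map_star, ← map_mul, Unitary.mul_star_self_of_mem U.2, map_one]
  -- For unitary `M` the adjugate is `det M` times the adjoint; its corner entry evaluates the
  -- determinant of `A`.
  have hadj : M.adjugate = M.det • star M := by
    rw [← Matrix.mul_one M.adjugate, ← hMM, ← Matrix.mul_assoc, Matrix.adjugate_mul,
      Matrix.smul_mul, Matrix.one_mul]
  have hcof : M 1 1 * M 2 2 - M 1 2 * M 2 1 = M.det * conj (M 0 0) := by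
    have := congrFun (congrFun hadj 0) 0
    rw [Matrix.adjugate_fin_three] at this
    simpa [Matrix.star_apply] using this
  rw [hchar, Matrix.charpoly_fin_two, Matrix.trace_fin_two, Matrix.det_fin_two, htr, hdet, ← hM0,
    ← hcof, Matrix.trace_fin_three]
  simp only [hN]
  congr 4
  change M 1 1 + M 2 2 = _
  ring

/-! ### Interior points force distinct eigenvalues -/

lemma interior_eq_empty_of_subset_line {s : Set ℂ} {a d : ℂ}
    (h : ∀ w ∈ s, ∃ t : ℝ, w = a + t * d) : interior s = ∅ := by
  rw [Set.eq_empty_iff_forall_notMem]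
  intro w hw
  obtain ⟨ε, hε, hball⟩ := Metric.mem_nhds_iff.1 (mem_interior_iff_mem_nhds.1 hw)
  have hmem : ∀ x : ℂ, ‖x‖ = 1 → ∃ t : ℝ, w + (ε / 2 : ℝ) * x = a + t * d := fun x hx => by
    refine h _ (hball ?_)
    rw [Metric.mem_ball, dist_self_add_left, norm_mul, hx, Complex.norm_real,
      Real.norm_of_nonneg (by positivity)]
    linarith
  obtain ⟨t₀, h₀⟩ := h w (hball (Metric.mem_ball_self hε))
  obtain ⟨t₁, h₁⟩ := hmem 1 (by simp)
  obtain ⟨t₂, h₂⟩ := hmem Complex.I (by simp)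
  have e1 : ((ε / 2 : ℝ) : ℂ) = (t₁ - t₀ : ℝ) * d := by push_cast; push_cast at h₁; linear_combination h₁ - h₀
  have e2 : ((ε / 2 : ℝ) : ℂ) * Complex.I = (t₂ - t₀ : ℝ) * d := by
    push_cast; push_cast at h₂; linear_combination h₂ - h₀
  -- Eliminating `d` equates an imaginary number with a real one, so `t₁ = t₀`, against `ε > 0`.
  have e3 : ((t₁ - t₀ : ℝ) : ℂ) * ((ε / 2 : ℝ) * Complex.I) = (t₂ - t₀ : ℝ) * (ε / 2 : ℝ) := by
    rw [e1, ← e1, e2, e1]; ring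
  have e4 := congrArg Complex.im e3
  rw [Complex.im_ofReal_mul, Complex.im_ofReal_mul, Complex.im_ofReal_mul, Complex.I_im,
    Complex.ofReal_im] at e4
  have e5 : t₁ - t₀ = 0 := by
    rcases mul_eq_zero.1 (e4.trans (mul_zero _)) with h | h
    · exact h
    · linarith
  rw [e5, Complex.ofReal_zero, zero_mul, Complex.ofReal_eq_zero] at e1
  linarith

/-- With a repeated eigenvalue, every convex combination of the eigenvalues lies on one line. -/
lemma injective_eigenvalues_of_interior_numRange {T : Op 3}
    {b : OrthonormalBasis (Fin 3) ℂ (Qudit 3)} {u : Fin 3 → ℂ} (h : ∀ i, T (b i) = u i • b i)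
    (hT : (interior (numRange T)).Nonempty) : Function.Injective u := by
  intro i j hu
  by_contra hij
  obtain ⟨k, hk⟩ : ∃ k, ∀ m, m = i ∨ m = j ∨ m = k := by
    clear hu; revert i j; decide
  refine hT.ne_empty (interior_eq_empty_of_subset_line (a := u i) (d := u k - u i) ?_)
  rintro w ⟨z, hz, rfl⟩
  refine ⟨‖⟪b k, z⟫_ℂ‖ ^ 2, ?_⟩
  have h1 : ∑ m, ((‖⟪b m, z⟫_ℂ‖ ^ 2 : ℝ) : ℂ) = 1 := by
    rw [← Complex.ofReal_sum, b.sum_sq_norm_inner_right z, hz]; simp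
  have h2 : ∑ m, ((‖⟪b m, z⟫_ℂ‖ ^ 2 : ℝ) : ℂ) * (u m - u i) =
      ((‖⟪b k, z⟫_ℂ‖ ^ 2 : ℝ) : ℂ) * (u k - u i) := by
    refine Finset.sum_eq_single k (fun m _ hm => ?_) (by simp)
    rcases hk m with rfl | rfl | rfl
    · simp
    · simp [hu]
    · exact absurd rfl hm
  rw [inner_apply_eq_sum_of_eigenbasis h, ← h2]
  simp_rw [mul_sub]
  rw [Finset.sum_sub_distrib, ← Finset.sum_mul, h1]
  ring

/-! ### Root pairs of equal modulus and their angle -/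

/-- Writing `t = 2 cos φ * l` gives `l ^ 2 = D` and roots `l * exp (± i φ)`. Their quotient has
principal argument `-2φ` because `0 < 2φ < π`. -/
lemma exists_roots_of_sq_eq {t D : ℂ} {φ : ℝ} (h0 : 0 < φ) (hφ : φ < Real.pi / 2)
    (ht : t ^ 2 = 4 * (Real.cos φ ^ 2 : ℝ) * D) (hD : D ≠ 0) (hD1 : ‖D‖ < 1) :
    ∃ l₁ l₂ : ℂ, (X ^ 2 - C t * X + C D : ℂ[X]).roots = {l₁, l₂} ∧
      0 < ‖l₂‖ ∧ ‖l₂‖ = ‖l₁‖ ∧ ‖l₁‖ < 1 ∧ Complex.arg (l₂ / l₁) = -(2 * φ) := by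
  have hcos : 0 < Real.cos φ := Real.cos_pos_of_mem_Ioo ⟨by linarith, hφ⟩
  have hc : (Real.cos φ : ℂ) ≠ 0 := Complex.ofReal_ne_zero.2 hcos.ne'
  obtain ⟨l, hl⟩ : ∃ l : ℂ, t = 2 * Real.cos φ * l := ⟨t / (2 * Real.cos φ), by field_simp⟩
  have hlD : l ^ 2 = D := by
    rw [hl] at ht
    push_cast at ht
    have : (4 * (Real.cos φ : ℂ) ^ 2) * l ^ 2 = (4 * (Real.cos φ : ℂ) ^ 2) * D := by
      push_cast; linear_combination ht
    exact mul_left_cancel₀ (mul_ne_zero four_ne_zero (pow_ne_zero 2 hc)) this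
  have hln : ‖l‖ ^ 2 = ‖D‖ := by rw [← norm_pow, hlD]
  have hl0 : l ≠ 0 := by rintro rfl; apply hD; rw [← hlD]; simp
  have hl1 : ‖l‖ < 1 := by
    by_contra! h
    nlinarith
  have hexp : ∀ x : ℝ, ‖Complex.exp (x * Complex.I)‖ = 1 := Complex.norm_exp_ofReal_mul_I
  have hE : Complex.exp (φ * Complex.I) * Complex.exp ((-φ : ℝ) * Complex.I) = 1 := by
    rw [← Complex.exp_add, ← Complex.exp_zero]; congr 1; push_cast; ring
  have hS : Complex.exp (φ * Complex.I) + Complex.exp ((-φ : ℝ) * Complex.I) = 2 * Real.cos φ := by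
    rw [Complex.ofReal_cos, Complex.two_cos]; push_cast; ring
  refine ⟨l * Complex.exp (φ * Complex.I), l * Complex.exp ((-φ : ℝ) * Complex.I), ?_, ?_, ?_, ?_, ?_⟩
  · have hp : (X ^ 2 - C t * X + C D : ℂ[X]) =
        (({l * Complex.exp (φ * Complex.I), l * Complex.exp ((-φ : ℝ) * Complex.I)} :
          Multiset ℂ).map fun a => X - C a).prod := by
      rw [hl, ← hlD, ← hS]
      have hE' := congrArg (C : ℂ → ℂ[X]) hE
      simp only [Multiset.insert_eq_cons, Multiset.map_cons, Multiset.map_singleton,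
        Multiset.prod_cons, Multiset.prod_singleton]
      simp only [C_mul, C_add, C_pow, C_1] at hE' ⊢
      linear_combination (-(C l) ^ 2) * hE'
    rw [hp, roots_multiset_prod_X_sub_C]
  · rw [norm_mul, hexp, mul_one]; exact norm_pos_iff.2 hl0
  · rw [norm_mul, norm_mul, hexp, hexp]
  · rwa [norm_mul, hexp, mul_one]
  · have : l * Complex.exp ((-φ : ℝ) * Complex.I) / (l * Complex.exp (φ * Complex.I)) =
        Complex.cos (-(2 * φ) : ℝ) + Complex.sin (-(2 * φ) : ℝ) * Complex.I := by
      rw [mul_div_mul_left _ _ hl0, ← Complex.exp_sub, ← Complex.exp_mul_I]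
      congr 1; push_cast; ring
    rw [this]
    exact Complex.arg_cos_add_sin_mul_I ⟨by linarith, by linarith⟩

lemma inPiRat_neg_two_mul {φ : ℝ} : InPiRat (-(2 * φ)) ↔ InPiRat φ := by
  constructor
  · rintro ⟨q, hq⟩
    exact ⟨-q / 2, by push_cast; linarith⟩
  · rintro ⟨q, rfl⟩
    exact ⟨-2 * q, by push_cast; ring⟩

lemma infinite_Ioo_inter_inPiRat {α β : ℝ} (h : α < β) :
    (Set.Ioo α β ∩ {φ | InPiRat φ}).Infinite := by
  have hπ := Real.pi_pos
  obtain ⟨q₀, h1, h2⟩ := exists_rat_btwn (div_lt_div_of_pos_right h hπ)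
  obtain ⟨q₁, h3, h4⟩ := exists_rat_btwn h2
  have hq : q₀ < q₁ := by exact_mod_cast h3
  refine Set.infinite_of_injOn_mapsTo (s := Set.Ioo q₀ q₁) (f := fun q : ℚ => Real.pi * (q : ℝ))
    ?_ ?_ (Set.Ioo_infinite hq)
  · intro x _ y _ hxy
    exact_mod_cast mul_left_cancel₀ hπ.ne' hxy
  · rintro q ⟨h5, h6⟩
    have h5' : (q₀ : ℝ) < q := by exact_mod_cast h5
    have h6' : (q : ℝ) < q₁ := by exact_mod_cast h6
    refine ⟨⟨?_, ?_⟩, q, rfl⟩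
    · rw [← div_lt_iff₀' hπ]; linarith
    · rw [← lt_div_iff₀' hπ]; linarith

lemma infinite_Ioo_inter_not_inPiRat {α β : ℝ} (h : α < β) :
    (Set.Ioo α β ∩ {φ | ¬ InPiRat φ}).Infinite := by
  have hcount : {φ | InPiRat φ}.Countable := by
    refine (Set.countable_range fun q : ℚ => Real.pi * (q : ℝ)).mono ?_
    rintro _ ⟨q, rfl⟩
    exact ⟨q, rfl⟩
  intro hfin
  refine (Cardinal.Real.Ioo_countable_iff.not.2 h.not_ge) ((hfin.countable.union hcount).mono ?_)
  intro x hx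
  by_cases hx' : InPiRat x
  · exact Or.inr hx'
  · exact Or.inl ⟨hx, hx'⟩

/-! ### Elliptic families and the theorem -/

/-- If the numerical range has interior points, it contains a one-parameter family of points `g φ`
for which the operator `A` has eigenvalues `l₁`, `l₂` of equal modulus in `(0, 1)` with
`l₂ / l₁ = exp (-2 i φ)`. -/
lemma exists_elliptic_family (U : unitary (Op 3))
    (hU : (interior (numRange (U : Op 3))).Nonempty) :
    ∃ (α β : ℝ) (g : ℝ → ℂ), α < β ∧ Set.Ioo α β ⊆ Set.Ioo 0 (Real.pi / 2) ∧
      Set.InjOn g (Set.Ioo α β) ∧ ∀ φ ∈ Set.Ioo α β, g φ ∈ numRange (U : Op 3) ∧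
        ∀ z : Qudit 3, ‖z‖ = 1 → ⟪z, (U : Op 3) z⟫_ℂ = g φ →
          ∃ l₁ l₂ : ℂ, (ballOp U z).charpoly.roots = {l₁, l₂} ∧
            0 < ‖l₂‖ ∧ ‖l₂‖ = ‖l₁‖ ∧ ‖l₁‖ < 1 ∧ Complex.arg (l₂ / l₁) = -(2 * φ) := by
  obtain ⟨e, u, he, hu⟩ := exists_orthonormalBasis_eigenvectors U
  have hinj := injective_eigenvalues_of_interior_numRange he hU
  obtain ⟨a, b, ha, hab, hb, hsol⟩ := exists_Ioo_solution (hu 0) (hu 1) (hu 2)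
    (hinj.ne (by decide)) (hinj.ne (by decide)) (hinj.ne (by decide))
  choose! g hg using hsol
  have hrange : ({u 0, u 1, u 2} : Set ℂ) = Set.range u := by
    ext w; simp [Fin.exists_fin_succ, eq_comm]
  have hδ : u 0 * u 1 * u 2 ≠ 0 := norm_ne_zero_iff.1 (by simp [hu])
  -- The substitution `c = cos² φ` is decreasing on `[0, π/2]`, so the endpoints `a`, `b` change
  -- places.
  have hI : ∀ φ ∈ Set.Ioo (Real.arccos √b) (Real.arccos √a),
      φ ∈ Set.Ioo 0 (Real.pi / 2) ∧ Real.cos φ ^ 2 ∈ Set.Ioo a b := by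
    rintro φ ⟨h1, h2⟩
    have hsb : √b ≤ 1 := Real.sqrt_le_one.2 hb
    have hsa : √a ≤ 1 := Real.sqrt_le_one.2 (hab.le.trans hb)
    have hsa0 := Real.sqrt_nonneg a
    have hsb0 := Real.sqrt_nonneg b
    have h3 : 0 < φ := (Real.arccos_nonneg _).trans_lt h1
    have h4 : φ < Real.pi / 2 := h2.trans_le (Real.arccos_le_pi_div_two.2 hsa0)
    have hφ : φ ∈ Set.Icc 0 Real.pi := ⟨h3.le, by linarith [Real.pi_pos]⟩
    have h5 := Real.strictAntiOn_cos ⟨Real.arccos_nonneg _, Real.arccos_le_pi _⟩ hφ h1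
    have h6 := Real.strictAntiOn_cos hφ ⟨Real.arccos_nonneg _, Real.arccos_le_pi _⟩ h2
    rw [Real.cos_arccos (by linarith) hsb] at h5
    rw [Real.cos_arccos (by linarith) hsa] at h6
    exact ⟨⟨h3, h4⟩, (Real.sqrt_lt' (hsa0.trans_lt h6)).1 h6,
      (Real.lt_sqrt (hsa0.trans h6.le)).1 h5⟩
  refine ⟨Real.arccos √b, Real.arccos √a, fun φ => g (Real.cos φ ^ 2), ?_, fun φ hφ => (hI φ hφ).1,
    ?_, ?_⟩
  · exact Real.strictAntiOn_arccos ⟨by linarith [Real.sqrt_nonneg a], Real.sqrt_le_one.2 (by linarith)⟩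
      ⟨by linarith [Real.sqrt_nonneg b], Real.sqrt_le_one.2 hb⟩ (Real.sqrt_lt_sqrt ha hab)
  · intro x hx y hy hxy
    obtain ⟨⟨hx0, hx1⟩, hxc⟩ := hI x hx
    obtain ⟨⟨hy0, hy1⟩, hyc⟩ := hI y hy
    obtain ⟨-, h1, hne, -⟩ := hg _ hxc
    obtain ⟨-, h2, -, -⟩ := hg _ hyc
    simp only at hxy
    rw [← hxy, h1] at h2
    have h3 : conj (g (Real.cos x ^ 2)) ≠ 0 := by simpa using hne
    -- As `δ * conj w ≠ 0`, the equation determines `c` from `w`.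
    have h4 := mul_right_cancel₀ hδ (mul_right_cancel₀ h3 h2)
    have h5 : Real.cos x ^ 2 = Real.cos y ^ 2 := by
      exact_mod_cast mul_left_cancel₀ (four_ne_zero) h4
    have h6 := (pow_left_inj₀ (Real.cos_pos_of_mem_Ioo ⟨by linarith, hx1⟩).le
      (Real.cos_pos_of_mem_Ioo ⟨by linarith, hy1⟩).le two_ne_zero).1 h5
    exact Real.injOn_cos ⟨hx0.le, by linarith⟩ ⟨hy0.le, by linarith⟩ h6
  · intro φ hφ
    obtain ⟨⟨h0, h1⟩, hc⟩ := hI φ hφ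
    obtain ⟨hw, heq, hne, hlt⟩ := hg _ hc
    refine ⟨convexHull_subset_numRange he (hrange ▸ hw), fun z hz hzw => ?_⟩
    rw [charpoly_ballOp U hz, trace_eq_sum_of_eigenbasis he, det_eq_prod_of_eigenbasis he, hzw,
      Fin.sum_univ_three, Fin.prod_univ_three]
    refine exists_roots_of_sq_eq h0 h1 (by rw [heq, mul_assoc]) ?_ ?_
    · exact mul_ne_zero hδ (by simpa using hne)
    · simpa [hu] using hlt

theorem mainTheorem3 (U : unitary (Op 3)) (hU : (interior (numRange (U : Op 3))).Nonempty) :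
    {w : ℂ | w ∈ numRange (U : Op 3) ∧
      ∀ (z : Qudit 3) (hz : ‖z‖ = 1), ⟪z, (U : Op 3) z⟫_ℂ = w →
        (pifsOf U (ballPointPVM z hz)).GeneratesFiniteEllipticChain}.Infinite ∧
    {w : ℂ | w ∈ numRange (U : Op 3) ∧
      ∀ (z : Qudit 3) (hz : ‖z‖ = 1), ⟪z, (U : Op 3) z⟫_ℂ = w →
        (pifsOf U (ballPointPVM z hz)).GeneratesInftyEllipticChain}.Infinite := by
  obtain ⟨α, β, g, hαβ, hsub, hinj, hg⟩ := exists_elliptic_family U hU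
  constructor
  · refine Set.infinite_of_injOn_mapsTo (hinj.mono Set.inter_subset_left) ?_
      (infinite_Ioo_inter_inPiRat hαβ)
    rintro φ ⟨hφ, hrat⟩
    refine ⟨(hg φ hφ).1, fun z hz hzw => ⟨U, z, hz, rfl, ?_⟩⟩
    obtain ⟨l₁, l₂, hr, h1, h2, h3, harg⟩ := (hg φ hφ).2 z hz hzw
    refine ⟨l₁, l₂, hr, h1, h2, h3, ?_, ?_⟩
    · rw [harg]; exact inPiRat_neg_two_mul.2 hrat
    · rw [harg]; linarith [(hsub hφ).1]
  · refine Set.infinite_of_injOn_mapsTo (hinj.mono Set.inter_subset_left) ?_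
      (infinite_Ioo_inter_not_inPiRat hαβ)
    rintro φ ⟨hφ, hrat⟩
    refine ⟨(hg φ hφ).1, fun z hz hzw => ⟨U, z, hz, rfl, ?_⟩⟩
    obtain ⟨l₁, l₂, hr, h1, h2, h3, harg⟩ := (hg φ hφ).2 z hz hzw
    exact ⟨l₁, l₂, hr, h1, h2, h3, by rw [harg]; exact inPiRat_neg_two_mul.not.2 hrat⟩
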